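/- Algebras are finitary (each primitive operation has finite arity, but there may be infinitely many operations), and the empty algebra is admitted when there are no zeroary operations. A *quasivariety* is a class $\mathbf{P}$ of algebras of a given type that can be defined by implications $(\forall x_1,\dots,x_n)\ \bigl(\bigwedge_{j=1}^{m} a_j(x)=b_j(x)\bigr)\Rightarrow c(x)=d(x)$, where $n,m\ge 0$ are finite and $a_j,b_j,c,d$ are terms; the quasivariety *generated by* a class of algebras is the least quasivariety containing it. An algebra $A\in\mathbf{P}$ is *subdirectly irreducible in* $\mathbf{P}$ if, whenever $A$ is represented as a subdirect product of a (possibly empty) family of algebras in $\mathbf{P}$, one of the projections is an isomorphism. A set $\mathbf{X}$ of algebras in $\mathbf{P}$ is *$\mathbf{P}$-compatible* if there is an algebra $B$ in $\mathbf{P}$ admitting one-to-one homomorphisms $A\to B$ for all $A\in\mathbf{X}$. For a quasivariety $\mathbf{P}$ and a cardinal $\kappa$, consider the conditions (a) every set $\mathbf{X}$ of algebras subdirectly irreducible in $\mathbf{P}$ can be written as the union of at most $\kappa$ subsets, each of which is $\mathbf{P}$-compatible; (b) $\mathbf{P}$ can be generated as a quasivariety by at most $\kappa$ algebras. **Corollary.**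 For every quasivariety $\mathbf{P}$ and every cardinal $\kappa$, (a) implies (b) (no residual smallness of $\mathbf{P}$ is assumed). If $\kappa$ is finite, then also (b) implies (a). On the other hand, for every infinite cardinal $\kappa$ the converse fails: the variety of sets given with a $\kappa$-tuple of zeroary operations (constants), with no identities, is a quasivariety that satisfies (b) but not (a). -/

import Mathlib

open Cardinal

universe u

namespace UniversalAlgebra

/-- An algebra of the finitary type `L` (a first-order language without relation symbols; the
operations of arity `n` are `L.Functions n`). The carrier may be empty if there are no zeroary
operations. Sets are modelled by `Type u`, classes of algebras by `Set (Alg L)`. -/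
abbrev Alg (L : FirstOrder.Language.{u, 0}) : Type (u + 1) := CategoryTheory.Bundled.{u} L.Structure

variable {L : FirstOrder.Language.{u, 0}}

/-- A finite implication `⋀ⱼ aⱼ(x) = bⱼ(x) ⟹ c(x) = d(x)` in finitely many variables. -/
structure QuasiIdentity (L : FirstOrder.Language.{u, 0}) : Type u where
  /-- number of variables -/
  n : ℕ
  /-- the finitely many premises `aⱼ = bⱼ` (possibly none) -/
  premises : List (L.Term (Fin n) × L.Term (Fin n))
  /-- the conclusion `c = d` -/
  conclusion : L.Term (Fin n) × L.Term (Fin n)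

/-- The algebra `A` satisfies the implication `φ` for all values of the variables. -/
def QuasiIdentity.Holds (φ : QuasiIdentity L) (A : Alg L) : Prop :=
  ∀ x : Fin φ.n → A, (∀ p ∈ φ.premises, p.1.realize x = p.2.realize x) →
    φ.conclusion.1.realize x = φ.conclusion.2.realize x

/-- A quasivariety: a class of algebras definable by finite implications. -/
def IsQuasivariety (P : Set (Alg L)) : Prop :=
  ∃ Γ : Set (QuasiIdentity L), P = {A | ∀ φ ∈ Γ, φ.Holds A}

/-- A variety: a class of algebras definable by identities (implications without premises). -/
def IsVariety (P : Set (Alg L)) : Prop :=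
  ∃ Γ : Set (QuasiIdentity L), (∀ φ ∈ Γ, φ.premises = []) ∧ P = {A | ∀ φ ∈ Γ, φ.Holds A}

/-- `P` is the quasivariety generated by the class `X`: the least quasivariety containing `X`. -/
def IsQuasivarietyGeneratedBy (P X : Set (Alg L)) : Prop :=
  IsLeast {Q : Set (Alg L) | IsQuasivariety Q ∧ X ⊆ Q} P

/-- `P` can be generated as a quasivariety by at most `κ` algebras. -/
def GeneratedByAtMost (P : Set (Alg L)) (κ : Cardinal.{u}) : Prop :=
  ∃ I : Type u, #I ≤ κ ∧ ∃ A : I → Alg L, IsQuasivarietyGeneratedBy P (Set.range A)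

/-- `A` is subdirectly irreducible in `P`: it lies in `P`, and whenever it is represented as a
subdirect product of a family of members of `P` (that is, by surjective homomorphisms onto them
which together separate the points of `A`), one of the projections is an isomorphism. The family
may be empty, so algebras with at most one element are not subdirectly irreducible. -/
def IsSubdirectlyIrreducibleIn (P : Set (Alg L)) (A : Alg L) : Prop :=
  A ∈ P ∧ ∀ (I : Type u) (B : I → Alg L) (f : ∀ i, FirstOrder.Language.Hom L A (B i)),
    (∀ i, B i ∈ P) → (∀ i, Function.Surjective (f i)) →
    (∀ x y : A, (∀ i, f i x = f i y) → x = y) →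
    ∃ i, Function.Bijective (f i)

/-- A set `X` of members of `P` is `P`-compatible if some member of `P` admits one-to-one
homomorphisms from all members of `X`. -/
def IsCompatible (P X : Set (Alg L)) : Prop :=
  X ⊆ P ∧ ∃ B ∈ P, ∀ A ∈ X, ∃ f : FirstOrder.Language.Hom L A B, Function.Injective f

/-- Every set (as opposed to proper class) `X` of algebras subdirectly irreducible in `P` is the
union of at most `κ` subsets, each of them `P`-compatible. -/
def DecomposesIntoAtMost (P : Set (Alg L)) (κ : Cardinal.{u}) : Prop :=
  ∀ X : Set (Alg L), Small.{u} X → (∀ A ∈ X, IsSubdirectlyIrreducibleIn P A) →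
    ∃ I : Type u, #I ≤ κ ∧ ∃ Y : I → Set (Alg L), X = ⋃ i, Y i ∧ ∀ i, IsCompatible P (Y i)

/-- The class of all sets with a family of constants indexed by `C`, subject to no conditions:
all algebras whose only operations are the zeroary ones `c ∈ C`. -/
def setsWithConstants (C : Type u) : Set (Alg (FirstOrder.Language.constantsOn C)) := Set.univ

end UniversalAlgebra

namespace UniversalAlgebra

open FirstOrder FirstOrder.Language FirstOrder.Language.Structure

variable {L : FirstOrder.Language.{u, 0}}

/-! (a) ⇒ (b): by Zorn, every implication failing in `P` fails in some subdirectly irreducible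
member. Implications form a set, so a set of such members refutes them all. Since validity passes
down injective homomorphisms, the targets `B i` of its compatible pieces refute them too, hence
generate `P`.

(b) ⇒ (a), `κ` finite: a subdirectly irreducible `A` has a critical pair `a ≠ b`, so each equation
false in `A`, with finitely many true ones, entails `a = b` in `P`. If `A` locally embedded in no
generator, the finitely many obstructions would combine into one implication valid in all generators
but not in `A`. Algebras locally embedding in the same generator embed jointly in an ultrapower of
it.

Infinite `κ`: only `κ` implications exist, giving (b). But compatible algebras have the same
equalities between constants, while two-element algebras realize `2 ^ κ` patterns. -/

theorem isQuasivarietyGeneratedBy_iff {P X : Set (Alg L)} (hP : IsQuasivariety P) :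
    IsQuasivarietyGeneratedBy P X ↔
      X ⊆ P ∧ ∀ φ : QuasiIdentity L, (∀ A ∈ X, φ.Holds A) → ∀ A ∈ P, φ.Holds A := by
  constructor
  · rintro ⟨⟨-, hX⟩, hmin⟩
    refine ⟨hX, fun φ hφ A hA => ?_⟩
    have hle : P ⊆ {A | ∀ ψ ∈ ({φ} : Set (QuasiIdentity L)), ψ.Holds A} :=
      hmin ⟨⟨_, rfl⟩, fun B hB ψ hψ => by
        rw [Set.mem_singleton_iff.1 hψ]
        exact hφ B hB⟩
    exact hle hA φ rfl
  · rintro ⟨hX, h⟩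
    refine ⟨⟨hP, hX⟩, ?_⟩
    rintro Q ⟨⟨Γ, rfl⟩, hXQ⟩ A hA φ hφ
    exact h φ (fun B hB => hXQ hB φ hφ) A hA

/-- Validity of an implication is inherited along injective homomorphisms. -/
theorem QuasiIdentity.Holds.of_injective {φ : QuasiIdentity L} {A B : Alg L} (hB : φ.Holds B)
    (f : A →[L] B) (hf : Function.Injective f) : φ.Holds A := by
  intro x hx
  apply hf
  rw [← HomClass.realize_term, ← HomClass.realize_term]
  refine hB _ fun p hp => ?_
  rw [HomClass.realize_term, HomClass.realize_term, hx p hp]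

/-! ### Congruences with quotient in a quasivariety -/

/-- `R` is a congruence of `A` such that the quotient satisfies all implications in `Γ`. -/
structure IsCongruenceOver (Γ : Set (QuasiIdentity L)) (A : Alg L) (R : Set (A × A)) : Prop where
  refl : ∀ a, (a, a) ∈ R
  symm : ∀ {a b}, (a, b) ∈ R → (b, a) ∈ R
  trans : ∀ {a b c}, (a, b) ∈ R → (b, c) ∈ R → (a, c) ∈ R
  funMap : ∀ {n : ℕ} (f : L.Functions n) (x y : Fin n → A), (∀ i, (x i, y i) ∈ R) →
    (funMap f x, funMap f y) ∈ R
  holds : ∀ φ ∈ Γ, ∀ x : Fin φ.n → A,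
    (∀ p ∈ φ.premises, (p.1.realize x, p.2.realize x) ∈ R) →
      (φ.conclusion.1.realize x, φ.conclusion.2.realize x) ∈ R

theorem IsCongruenceOver.exists_quotient [L.IsAlgebraic] {Γ : Set (QuasiIdentity L)} {A : Alg L}
    {R : Set (A × A)} (hR : IsCongruenceOver Γ A R) :
    ∃ B : Alg L, (∀ φ ∈ Γ, φ.Holds B) ∧ ∃ f : A →[L] B, Function.Surjective f ∧
      ∀ a b, f a = f b ↔ (a, b) ∈ R := by
  let s : Setoid A := ⟨fun a b => (a, b) ∈ R, hR.refl, hR.symm, hR.trans⟩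
  let str : L.Structure (Quotient s) :=
    { funMap := fun f x => Quotient.mk s (Structure.funMap f fun i => (x i).out)
      RelMap := fun r _ => isEmptyElim r }
  have hmk : ∀ a b, Quotient.mk s a = Quotient.mk s b ↔ (a, b) ∈ R := fun a b => Quotient.eq
  let f : A →[L] Quotient s :=
    { toFun := Quotient.mk s
      map_fun' := fun g x =>
        (hmk _ _).2 (hR.funMap g _ _ fun i => (hmk _ _).1 (Quotient.out_eq _).symm)
      map_rel' := fun r _ => isEmptyElim r }
  have hf : ∀ a b, f a = f b ↔ (a, b) ∈ R := hmk
  have hsurj : Function.Surjective f := Quotient.mk_surjective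
  refine ⟨⟨Quotient s, str⟩, fun φ hφ y => ?_, f, hsurj, hf⟩
  obtain ⟨x, rfl⟩ : ∃ x : Fin φ.n → A, f ∘ x = y :=
    ⟨fun i => (hsurj (y i)).choose, funext fun i => (hsurj (y i)).choose_spec⟩
  intro h
  have key : ∀ p : L.Term (Fin φ.n) × L.Term (Fin φ.n),
      p.1.realize (f ∘ x) = p.2.realize (f ∘ x) ↔ (p.1.realize x, p.2.realize x) ∈ R := by
    intro p
    rw [HomClass.realize_term, HomClass.realize_term, hf]
  exact (key _).2 (hR.holds φ hφ x fun p hp => (key p).1 (h p hp))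

theorem isCongruenceOver_ker {Γ : Set (QuasiIdentity L)} {A B : Alg L}
    (hB : ∀ φ ∈ Γ, φ.Holds B) (f : A →[L] B) :
    IsCongruenceOver Γ A {p | f p.1 = f p.2} where
  refl _ := rfl
  symm h := h.symm
  trans h h' := h.trans h'
  funMap g x y h := by
    simp only [Set.mem_ofPred_eq, Hom.map_fun] at h ⊢
    exact congrArg _ (funext h)
  holds φ hφ x h := by
    simp only [Set.mem_ofPred_eq, ← HomClass.realize_term] at h ⊢
    exact hB φ hφ _ h

/-- Each closure condition has finitely many hypotheses (finite arities, finitely many premises), so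
one member of the chain already contains them all. -/
theorem isCongruenceOver_sUnion {Γ : Set (QuasiIdentity L)} {A : Alg L} {c : Set (Set (A × A))}
    (hc : ∀ R ∈ c, IsCongruenceOver Γ A R) (hchain : IsChain (· ⊆ ·) c) (hne : c.Nonempty) :
    IsCongruenceOver Γ A (⋃₀ c) := by
  have key : ∀ s : Set (A × A), s.Finite → s ⊆ ⋃₀ c → ∃ R ∈ c, s ⊆ R := fun s hs hsub =>
    hchain.directedOn.exists_mem_subset_of_finite_of_subset_sUnion hne hs hsub
  refine ⟨fun a => ?_, ?_, ?_, ?_, ?_⟩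
  · obtain ⟨R, hR⟩ := hne
    exact ⟨R, hR, (hc R hR).refl a⟩
  · rintro a b ⟨R, hR, h⟩
    exact ⟨R, hR, (hc R hR).symm h⟩
  · intro a b d h h'
    obtain ⟨R, hR, hs⟩ := key {(a, b), (b, d)} (Set.toFinite _)
      (Set.insert_subset h (Set.singleton_subset_iff.2 h'))
    exact ⟨R, hR, (hc R hR).trans (hs (Set.mem_insert _ _)) (hs (Set.mem_insert_of_mem _ rfl))⟩
  · intro n f x y h
    obtain ⟨R, hR, hs⟩ := key (Set.range fun i => (x i, y i)) (Set.finite_range _)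
      (Set.range_subset_iff.2 h)
    exact ⟨R, hR, (hc R hR).funMap f x y fun i => hs ⟨i, rfl⟩⟩
  · intro φ hφ x h
    obtain ⟨R, hR, hs⟩ := key
      ((fun p : L.Term (Fin φ.n) × L.Term (Fin φ.n) => (p.1.realize x, p.2.realize x)) ''
        {p | p ∈ φ.premises}) (φ.premises.finite_toSet.image _) (Set.image_subset_iff.2 h)
    exact ⟨R, hR, (hc R hR).holds φ hφ x fun p hp => hs ⟨p, hp, rfl⟩⟩

/-- Any two distinct elements of a member of a quasivariety are separated by a homomorphism onto a
subdirectly irreducible member that identifies a maximal set of pairs. -/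
theorem exists_subdirectlyIrreducible_separating [L.IsAlgebraic] {P : Set (Alg L)}
    (hP : IsQuasivariety P) {A : Alg L} (hA : A ∈ P) {a b : A} (hab : a ≠ b) :
    ∃ B : Alg L, IsSubdirectlyIrreducibleIn P B ∧ ∃ f : A →[L] B, f a ≠ f b := by
  obtain ⟨Γ, rfl⟩ := hP
  obtain ⟨R, -, hR⟩ := zorn_subset_nonempty {R | IsCongruenceOver Γ A R ∧ (a, b) ∉ R}
    (fun c hc hchain hne => ⟨⋃₀ c,
      ⟨isCongruenceOver_sUnion (fun R hR => (hc hR).1) hchain hne,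
        fun ⟨R, hR, h⟩ => (hc hR).2 h⟩, fun s hs => Set.subset_sUnion_of_mem hs⟩)
    {p | Hom.id L A p.1 = Hom.id L A p.2} ⟨isCongruenceOver_ker hA _, hab⟩
  obtain ⟨B, hB, f, hsurj, hf⟩ := hR.prop.1.exists_quotient
  have hfab : f a ≠ f b := fun h => hR.prop.2 ((hf a b).1 h)
  refine ⟨B, ⟨hB, fun I C g hC hg hsep => ?_⟩, f, hfab⟩
  obtain ⟨i, hi⟩ : ∃ i, g i (f a) ≠ g i (f b) := by
    by_contra! h
    exact hfab (hsep _ _ h)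
  refine ⟨i, ?_, hg i⟩
  -- The kernel of `(g i).comp f` contains `R` and omits `(a, b)`, so by maximality it equals `R`.
  have hle : R ⊆ {p | (g i).comp f p.1 = (g i).comp f p.2} := fun p hp =>
    congrArg (g i) ((hf p.1 p.2).2 hp)
  have hge := hR.le_of_ge ⟨isCongruenceOver_ker (hC i) ((g i).comp f), hi⟩ hle
  intro x y hxy
  obtain ⟨x, rfl⟩ := hsurj x
  obtain ⟨y, rfl⟩ := hsurj y
  exact (hf x y).2 (hge (show (x, y) ∈ _ from hxy))

/-- An implication that fails in a quasivariety fails in a subdirectly irreducible member. -/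
theorem exists_subdirectlyIrreducible_not_holds [L.IsAlgebraic] {P : Set (Alg L)}
    (hP : IsQuasivariety P) {A : Alg L} (hA : A ∈ P) {φ : QuasiIdentity L} (hφ : ¬ φ.Holds A) :
    ∃ B : Alg L, IsSubdirectlyIrreducibleIn P B ∧ ¬ φ.Holds B := by
  simp only [QuasiIdentity.Holds, not_forall] at hφ
  obtain ⟨x, hx, hne⟩ := hφ
  obtain ⟨B, hB, f, hf⟩ := exists_subdirectlyIrreducible_separating hP hA hne
  refine ⟨B, hB, fun h => hf ?_⟩
  rw [← HomClass.realize_term, ← HomClass.realize_term]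
  refine h _ fun p hp => ?_
  rw [HomClass.realize_term, HomClass.realize_term, hx p hp]

theorem GeneratedByAtMost.of_decomposesIntoAtMost [L.IsAlgebraic] {P : Set (Alg L)}
    (hP : IsQuasivariety P) {κ : Cardinal.{u}} (h : DecomposesIntoAtMost P κ) :
    GeneratedByAtMost P κ := by
  have key : ∀ φ : {φ : QuasiIdentity L // ∃ A ∈ P, ¬ φ.Holds A},
      ∃ B : Alg L, IsSubdirectlyIrreducibleIn P B ∧ ¬ φ.1.Holds B := by
    rintro ⟨φ, A, hA, hφ⟩
    exact exists_subdirectlyIrreducible_not_holds hP hA hφ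
  choose S hS hSφ using key
  obtain ⟨I, hI, Y, hXY, hY⟩ := h (Set.range S) (small_range S) (by
    rintro _ ⟨φ, rfl⟩
    exact hS φ)
  choose hYP B hBP hB using hY
  refine ⟨I, hI, B, (isQuasivarietyGeneratedBy_iff hP).2 ⟨Set.range_subset_iff.2 hBP, ?_⟩⟩
  intro φ hφ A hA
  by_contra hAφ
  let ψ : {φ : QuasiIdentity L // ∃ A ∈ P, ¬ φ.Holds A} := ⟨φ, A, hA, hAφ⟩
  have hmem : S ψ ∈ ⋃ i, Y i := hXY ▸ Set.mem_range_self ψ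
  obtain ⟨i, hi⟩ := Set.mem_iUnion.1 hmem
  obtain ⟨f, hf⟩ := hB i _ hi
  exact hSφ ψ ((hφ _ (Set.mem_range_self i)).of_injective f hf)

/-! ### Equations and entailment -/

/-- The equation `e` holds in `A` for the values `x` of the variables. -/
def Satisfies {α : Type*} {A : Type u} [L.Structure A] (x : α → A) (e : L.Term α × L.Term α) :
    Prop :=
  e.1.realize x = e.2.realize x

theorem exists_finset_realize_congr {α : Type u} (t : L.Term α) :
    ∃ V : Finset α, ∀ (A : Alg L) (x y : α → A), (∀ v ∈ V, x v = y v) →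
      t.realize x = t.realize y := by
  classical
  induction t with
  | var a => exact ⟨{a}, fun A x y h => h a (Finset.mem_singleton_self a)⟩
  | func f ts ih =>
    choose V hV using ih
    refine ⟨Finset.univ.biUnion V, fun A x y h => ?_⟩
    refine congrArg (funMap f) (funext fun i => hV i A x y fun v hv => h v ?_)
    exact Finset.mem_biUnion.2 ⟨i, Finset.mem_univ i, hv⟩

/-- A finite implication in variables from an arbitrary nonempty set is equivalent to one in
variables from a finite ordinal. -/
theorem exists_quasiIdentity {α : Type u} [Nonempty α] (E : Finset (L.Term α × L.Term α))
    (c : L.Term α × L.Term α) :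
    ∃ φ : QuasiIdentity L, ∀ B : Alg L,
      φ.Holds B ↔ ∀ x : α → B, (∀ e ∈ E, Satisfies x e) → Satisfies x c := by
  classical
  choose V hV using fun t : L.Term α => exists_finset_realize_congr t
  let a₀ : α := Classical.arbitrary α
  -- `a₀` serves as the junk value of `r` outside `W`.
  let W : Finset α := insert a₀ ((insert c E).biUnion fun e => V e.1 ∪ V e.2)
  have ha₀ : a₀ ∈ W := Finset.mem_insert_self _ _
  have hVW : ∀ e ∈ insert c E, V e.1 ⊆ W ∧ V e.2 ⊆ W := fun e he =>
    have h := (Finset.subset_biUnion_of_mem (fun e : L.Term α × L.Term α => V e.1 ∪ V e.2) he).trans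
      (Finset.subset_insert a₀ _)
    ⟨Finset.subset_union_left.trans h, Finset.subset_union_right.trans h⟩
  let r : α → Fin W.card := fun v => W.equivFin (if h : v ∈ W then ⟨v, h⟩ else ⟨a₀, ha₀⟩)
  let s : Fin W.card → α := fun i => W.equivFin.symm i
  have hsr : ∀ v ∈ W, s (r v) = v := fun v hv => by simp [s, r, hv]
  let ρ : L.Term α × L.Term α → L.Term (Fin W.card) × L.Term (Fin W.card) :=
    fun e => (e.1.relabel r, e.2.relabel r)
  have hρ : ∀ (B : Alg L) (y : Fin W.card → B) e, Satisfies y (ρ e) ↔ Satisfies (y ∘ r) e :=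
    fun B y e => by simp [Satisfies, ρ, Term.realize_relabel]
  have hW : ∀ (B : Alg L) (x : α → B), ∀ e ∈ insert c E,
      Satisfies (x ∘ s ∘ r) e ↔ Satisfies x e := by
    intro B x e he
    have h1 := hV e.1 B (x ∘ s ∘ r) x fun v hv => congrArg x (hsr v ((hVW e he).1 hv))
    have h2 := hV e.2 B (x ∘ s ∘ r) x fun v hv => congrArg x (hsr v ((hVW e he).2 hv))
    rw [Satisfies, Satisfies, h1, h2]
  refine ⟨⟨W.card, (E.image ρ).toList, ρ c⟩, fun B => ⟨fun h x hx => ?_, fun h y hy => ?_⟩⟩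
  · rw [← hW B x c (Finset.mem_insert_self c E)]
    refine (hρ B (x ∘ s) c).1 (h (x ∘ s) fun p hp => ?_)
    obtain ⟨e, he, rfl⟩ := Finset.mem_image.1 (Finset.mem_toList.1 hp)
    exact (hρ B (x ∘ s) e).2 ((hW B x e (Finset.mem_insert_of_mem he)).2 (hx e he))
  · exact (hρ B y c).2 (h (y ∘ r) fun e he => (hρ B y e).1
      (hy _ (Finset.mem_toList.2 (Finset.mem_image_of_mem ρ he))))

/-- Within the class `P`, the equation `q` between elements of `A` follows from `p` together with
finitely many equations that hold in `A`. -/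
def Entails (P : Set (Alg L)) (A : Alg L) (p q : L.Term A × L.Term A) : Prop :=
  ∃ E : Finset (L.Term A × L.Term A), (∀ e ∈ E, Satisfies (id : A → A) e) ∧
    ∀ B ∈ P, ∀ x : A → B, (∀ e ∈ E, Satisfies x e) → Satisfies x p → Satisfies x q

section Entails

variable {P : Set (Alg L)} {A : Alg L} {p q : L.Term A × L.Term A}

theorem Entails.refl : Entails P A p p :=
  ⟨∅, by simp, fun _ _ _ _ h => h⟩

theorem Entails.of_satisfies (h : Satisfies (id : A → A) q) : Entails P A p q :=
  ⟨{q}, by simpa using h, fun _ _ _ hx _ => hx q (Finset.mem_singleton_self q)⟩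

/-- A cut rule: the finite sets of auxiliary equations are pooled into one. -/
theorem Entails.of_finite {Q : Set (L.Term A × L.Term A)} (hQ : Q.Finite)
    (h : ∀ r ∈ Q, Entails P A p r)
    (hq : ∀ B ∈ P, ∀ x : A → B, (∀ r ∈ Q, Satisfies x r) → Satisfies x q) : Entails P A p q := by
  classical
  choose! E hE hEr using h
  refine ⟨hQ.toFinset.biUnion E, fun e he => ?_, fun B hB x hx hp => hq B hB x fun r hr => ?_⟩
  · obtain ⟨r, hr, he⟩ := Finset.mem_biUnion.1 he
    exact hE r (hQ.mem_toFinset.1 hr) e he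
  · exact hEr r hr B hB x (fun e he => hx e (Finset.mem_biUnion.2 ⟨r, hQ.mem_toFinset.2 hr, he⟩)) hp

theorem entails_iff_entails_var :
    Entails P A p q ↔ Entails P A p (Term.var (q.1.realize id), Term.var (q.2.realize id)) := by
  have h1 : Entails P A p (q.1, Term.var (q.1.realize id)) := .of_satisfies rfl
  have h2 : Entails P A p (q.2, Term.var (q.2.realize id)) := .of_satisfies rfl
  constructor <;> intro h
  · refine .of_finite (Set.toFinite {q, (q.1, Term.var (q.1.realize id)),
      (q.2, Term.var (q.2.realize id))}) (by simp [h, h1, h2]) fun B _ x hx => ?_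
    simp only [Set.mem_insert_iff, Set.mem_singleton_iff, forall_eq_or_imp, forall_eq] at hx
    exact hx.2.1.symm.trans (hx.1.trans hx.2.2)
  · refine .of_finite (Set.toFinite {(Term.var (q.1.realize id), Term.var (q.2.realize id)),
      (q.1, Term.var (q.1.realize id)), (q.2, Term.var (q.2.realize id))})
      (by simp [h, h1, h2]) fun B _ x hx => ?_
    simp only [Set.mem_insert_iff, Set.mem_singleton_iff, forall_eq_or_imp, forall_eq] at hx
    exact hx.2.1.trans (hx.1.trans hx.2.2.symm)

/-- This is the least congruence with quotient in the quasivariety that forces `p`. -/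
theorem isCongruenceOver_entails {Γ : Set (QuasiIdentity L)} {A : Alg L}
    (p : L.Term A × L.Term A) :
    IsCongruenceOver Γ A
      {r | Entails {B | ∀ φ ∈ Γ, φ.Holds B} A p (Term.var r.1, Term.var r.2)} where
  refl a := .of_satisfies rfl
  symm {a b} h := .of_finite (Set.finite_singleton (Term.var a, Term.var b)) (by simpa using h)
    fun B _ x hx => (hx _ rfl).symm
  trans {a b c} h h' := .of_finite
    (Set.toFinite {(Term.var a, Term.var b), (Term.var b, Term.var c)})
    (by
      rintro r (rfl | rfl)
      exacts [h, h'])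
    fun B _ x hx => (hx _ (Set.mem_insert _ _)).trans (hx _ (Set.mem_insert_of_mem _ rfl))
  funMap {n} f x y h := by
    refine (entails_iff_entails_var (q := (Term.func f fun i => Term.var (x i),
      Term.func f fun i => Term.var (y i)))).1 (.of_finite
        (Set.finite_range fun i => (Term.var (x i), Term.var (y i))) ?_ fun B _ z hz => ?_)
    · rintro _ ⟨i, rfl⟩
      exact h i
    · exact congrArg (Structure.funMap f) (funext fun i => hz _ ⟨i, rfl⟩)
  holds φ hφ x h := by
    have key : ∀ e : L.Term (Fin φ.n) × L.Term (Fin φ.n),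
        Entails {B | ∀ φ ∈ Γ, φ.Holds B} A p (Term.var (e.1.realize x), Term.var (e.2.realize x)) ↔
          Entails {B | ∀ φ ∈ Γ, φ.Holds B} A p (e.1.relabel x, e.2.relabel x) := fun e => by
      rw [entails_iff_entails_var (q := (e.1.relabel x, e.2.relabel x))]
      simp only [Term.realize_relabel, Function.id_comp]
    refine (key _).2 (.of_finite (Q := (fun e : L.Term (Fin φ.n) × L.Term (Fin φ.n) =>
      (e.1.relabel x, e.2.relabel x)) '' {e | e ∈ φ.premises})
      (φ.premises.finite_toSet.image _) ?_ fun B hB y hy => ?_)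
    · rintro _ ⟨e, he, rfl⟩
      exact (key e).1 (h e he)
    · simp only [Satisfies, Term.realize_relabel]
      refine hB φ hφ (y ∘ x) fun e he => ?_
      simpa only [Satisfies, Term.realize_relabel] using hy _ ⟨e, he, rfl⟩

end Entails

/-! ### Critical pairs and local embeddings -/

/-- A subdirectly irreducible algebra has a pair of distinct elements identified by all proper
quotients. -/
theorem IsSubdirectlyIrreducibleIn.exists_pair {P : Set (Alg L)} {A : Alg L}
    (hA : IsSubdirectlyIrreducibleIn P A) :
    ∃ a b : A, a ≠ b ∧ ∀ B ∈ P, ∀ f : A →[L] B, Function.Surjective f →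
      ¬ Function.Injective f → f a = f b := by
  by_contra! h
  choose B hB f hf hinj hne using h
  -- If `A` has at most one element, this family is empty and still yields the contradiction.
  obtain ⟨i, hi⟩ := hA.2 {i : A × A // i.1 ≠ i.2} (fun i => B _ _ i.2) (fun i => f _ _ i.2)
    (fun i => hB _ _ i.2) (fun i => hf _ _ i.2) (fun x y hxy => by
      by_contra hne'
      exact hne x y hne' (hxy ⟨(x, y), hne'⟩))
  exact hinj _ _ i.2 hi.1

/-- The quotient forcing `p` is proper because `p` fails in `A`, so it identifies the critical pair.
-/
theorem IsSubdirectlyIrreducibleIn.exists_pair_entails [L.IsAlgebraic] {P : Set (Alg L)}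
    (hP : IsQuasivariety P) {A : Alg L} (hA : IsSubdirectlyIrreducibleIn P A) :
    ∃ a b : A, a ≠ b ∧ ∀ p : L.Term A × L.Term A, ¬ Satisfies (id : A → A) p →
      Entails P A p (Term.var a, Term.var b) := by
  obtain ⟨a, b, hab, h⟩ := hA.exists_pair
  obtain ⟨Γ, rfl⟩ := hP
  refine ⟨a, b, hab, fun p hp => ?_⟩
  obtain ⟨B, hB, f, hsurj, hf⟩ := (isCongruenceOver_entails (Γ := Γ) p).exists_quotient
  refine (hf a b).1 (h B hB f hsurj fun hinj => hp (hinj ((hf _ _).2 ?_)))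
  exact entails_iff_entails_var.1 .refl

/-- Every finite system of equations and negated equations that is satisfied in `A` can be
satisfied in `M`. -/
def LocallyEmbeds (A M : Alg L) : Prop :=
  ∀ F : Finset (L.Term A × L.Term A), ∃ x : A → M, ∀ e ∈ F,
    (Satisfies x e ↔ Satisfies (id : A → A) e)

/-- If a quasivariety is generated by finitely many algebras, then each of its subdirectly
irreducible members locally embeds in one of these. -/
theorem IsSubdirectlyIrreducibleIn.exists_locallyEmbeds [L.IsAlgebraic] {P : Set (Alg L)}
    {I : Type*} [Finite I] {M : I → Alg L} (hP : IsQuasivariety P)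
    (hM : IsQuasivarietyGeneratedBy P (Set.range M)) {A : Alg L}
    (hA : IsSubdirectlyIrreducibleIn P A) : ∃ i, LocallyEmbeds A (M i) := by
  classical
  have := Fintype.ofFinite I
  obtain ⟨hMP, hgen⟩ := (isQuasivarietyGeneratedBy_iff hP).1 hM
  by_contra! hnot
  simp only [LocallyEmbeds, not_forall, not_exists] at hnot
  choose F hF using hnot
  obtain ⟨a, b, hab, hent⟩ := hA.exists_pair_entails hP
  choose! E hE hEab using hent
  let G : Finset (L.Term A × L.Term A) := Finset.univ.biUnion F
  -- The premises are the true equations of `G` and, for each false one, the true equations with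
  -- which it entails `a = b`.
  obtain ⟨φ, hφ⟩ := @exists_quasiIdentity L A ⟨a⟩
    (G.filter (fun e => Satisfies (id : A → A) e) ∪
      (G.filter fun e => ¬ Satisfies (id : A → A) e).biUnion E) (Term.var a, Term.var b)
  refine hab ((hφ A).1 (hgen φ ?_ A hA.1) id fun e he => ?_)
  · rintro _ ⟨i, rfl⟩
    refine (hφ (M i)).2 fun x hx => ?_
    obtain ⟨e, he, hne⟩ := hF i x
    have heG : e ∈ G := Finset.mem_biUnion.2 ⟨i, Finset.mem_univ i, he⟩
    by_cases heA : Satisfies (id : A → A) e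
    · exact absurd (iff_of_true (hx e (Finset.mem_union_left _ (Finset.mem_filter.2 ⟨heG, heA⟩))) heA)
        hne
    · refine hEab e heA (M i) (hMP ⟨i, rfl⟩) x (fun e' he' => hx e' (Finset.mem_union_right _
        (Finset.mem_biUnion.2 ⟨e, Finset.mem_filter.2 ⟨heG, heA⟩, he'⟩))) ?_
      by_contra hxe
      exact hne (iff_of_false hxe heA)
  · rcases Finset.mem_union.1 he with he | he
    · exact (Finset.mem_filter.1 he).2
    · obtain ⟨e', he', hee'⟩ := Finset.mem_biUnion.1 he
      exact hE e' (Finset.mem_filter.1 he').2 e hee'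

theorem mk_product_eq_iff {S M : Type u} {U : Ultrafilter S} {x y : S → M} :
    (x : (U : Filter S).Product fun _ => M) = (y : (U : Filter S).Product fun _ => M) ↔ ∀ᶠ s in U, x s = y s :=
  Quotient.eq''

/-! ### Ultrapowers -/

/-- Ultrapowers preserve finite implications. -/
theorem QuasiIdentity.Holds.ultrapower {φ : QuasiIdentity L} {M : Alg L} (h : φ.Holds M)
    {S : Type u} (U : Ultrafilter S) :
    φ.Holds ⟨(U : Filter S).Product fun _ => M, inferInstance⟩ := by
  intro y hy
  obtain ⟨x, rfl⟩ : ∃ x : Fin φ.n → S → M,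
      (fun i => (x i : (U : Filter S).Product fun _ => M)) = y :=
    ⟨fun i => (y i).out, funext fun i => Quotient.out_eq (y i)⟩
  have key : ∀ e : L.Term (Fin φ.n) × L.Term (Fin φ.n),
      (e.1.realize fun i => (x i : (U : Filter S).Product fun _ => M)) =
        (e.2.realize fun i => (x i : (U : Filter S).Product fun _ => M)) ↔
      ∀ᶠ s in U, (e.1.realize fun i => x i s) = e.2.realize fun i => x i s := fun e => by
    rw [Ultraproduct.term_realize_cast, Ultraproduct.term_realize_cast]
    exact mk_product_eq_iff
  refine (key _).2 ?_
  have hall : ∀ᶠ s in (U : Filter S), ∀ p ∈ {p | p ∈ φ.premises},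
      (p.1.realize fun i => x i s) = p.2.realize fun i => x i s :=
    (Filter.eventually_all_finite φ.premises.finite_toSet).2 fun p hp => (key p).1 (hy p hp)
  filter_upwards [hall] with s hs
  exact h _ hs

/-- Algebras that locally embed in `M` embed jointly in an ultrapower of `M`. -/
theorem exists_ultrapower_of_locallyEmbeds [L.IsAlgebraic] {J : Type u} {A : J → Alg L} {M : Alg L}
    (h : ∀ j, LocallyEmbeds (A j) M) :
    ∃ B : Alg L, (∀ φ : QuasiIdentity L, φ.Holds M → φ.Holds B) ∧
      ∀ j, ∃ f : A j →[L] B, Function.Injective f := by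
  classical
  -- An index picks a finite system for every algebra at once; under pointwise inclusion each
  -- equation eventually lies in `s j`, so one ultrafilter serves all `j`.
  let S : Type u := ∀ j, Finset (L.Term (A j) × L.Term (A j))
  choose g hg using h
  let U : Ultrafilter S := Ultrafilter.of Filter.atTop
  refine ⟨⟨(U : Filter S).Product fun _ => M, inferInstance⟩, fun φ hφ => hφ.ultrapower U,
    fun j => ?_⟩
  have hev : ∀ e : L.Term (A j) × L.Term (A j),
      ∀ᶠ s in (U : Filter S), (Satisfies (g j (s j)) e ↔ Satisfies (id : A j → A j) e) := by
    intro e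
    refine Ultrafilter.of_le _ ?_
    filter_upwards [Filter.eventually_ge_atTop (Function.update (⊥ : S) j {e})] with s hs
    refine hg j (s j) e (hs j ?_)
    simp
  let x : A j → S → M := fun a s => g j (s j) a
  refine ⟨{ toFun := fun a => (x a : (U : Filter S).Product fun _ => M)
            map_fun' := fun {n} f y => ?_
            map_rel' := fun r _ => isEmptyElim r }, fun a b hab => ?_⟩
  · refine Eq.trans ?_ (Ultraproduct.funMap_cast (u := U) f (x ∘ y)).symm
    refine mk_product_eq_iff.2 ?_
    filter_upwards [hev (Term.var (Structure.funMap f y), Term.func f fun i => Term.var (y i))]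
      with s hs
    exact hs.2 rfl
  · obtain ⟨s, hs, hs'⟩ :=
      ((hev (Term.var a, Term.var b)).and (mk_product_eq_iff.1 hab)).exists
    exact hs.1 hs'

theorem GeneratedByAtMost.decomposesIntoAtMost [L.IsAlgebraic] {P : Set (Alg L)}
    (hP : IsQuasivariety P) {κ : Cardinal.{u}} (hκ : κ < ℵ₀) (h : GeneratedByAtMost P κ) :
    DecomposesIntoAtMost P κ := by
  obtain ⟨I, hI, M, hM⟩ := h
  have : Finite I := lt_aleph0_iff_finite.1 (hI.trans_lt hκ)
  intro X hX hXsi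
  refine ⟨I, hI, fun i => {A ∈ X | LocallyEmbeds A (M i)}, ?_, fun i => ?_⟩
  · ext A
    simp only [Set.mem_iUnion, Set.mem_ofPred_eq, exists_and_left]
    exact ⟨fun hA => ⟨hA, (hXsi A hA).exists_locallyEmbeds hP hM⟩, And.left⟩
  · refine ⟨fun A hA => (hXsi A hA.1).1, ?_⟩
    obtain ⟨B, hB, hemb⟩ := exists_ultrapower_of_locallyEmbeds
      -- `X` lives one universe too high to index an ultrapower; its smallness allows reindexing.
      (A := fun j : {j : Shrink.{u} X // LocallyEmbeds ((equivShrink X).symm j : Alg L) (M i)} =>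
        ((equivShrink X).symm j.1 : Alg L)) fun j => j.2
    have hMP : M i ∈ P := hM.1.2 ⟨i, rfl⟩
    obtain ⟨Γ, rfl⟩ := hP
    refine ⟨B, fun φ hφ => hB φ (hMP φ hφ), fun A hA => ?_⟩
    have hj : (equivShrink X).symm (equivShrink X ⟨A, hA.1⟩) = ⟨A, hA.1⟩ :=
      Equiv.symm_apply_apply _ _
    have := hemb ⟨equivShrink X ⟨A, hA.1⟩, by rw [hj]; exact hA.2⟩
    rwa [hj] at this

/-! ### Counting implications -/

/-- Every quasivariety is generated by at most as many algebras as there are implications. -/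
theorem IsQuasivariety.generatedByAtMost {P : Set (Alg L)} (hP : IsQuasivariety P) :
    GeneratedByAtMost P #(QuasiIdentity L) := by
  have key : ∀ φ : {φ : QuasiIdentity L // ∃ A ∈ P, ¬ φ.Holds A}, ∃ A ∈ P, ¬ φ.1.Holds A :=
    fun φ => φ.2
  choose S hS hSφ using key
  refine ⟨_, mk_subtype_le _, S, (isQuasivarietyGeneratedBy_iff hP).2
    ⟨Set.range_subset_iff.2 hS, fun φ hφ A hA => ?_⟩⟩
  by_contra hAφ
  exact hSφ ⟨φ, A, hA, hAφ⟩ (hφ _ ⟨_, rfl⟩)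

theorem GeneratedByAtMost.mono {P : Set (Alg L)} {κ κ' : Cardinal.{u}}
    (h : GeneratedByAtMost P κ) (hκ : κ ≤ κ') : GeneratedByAtMost P κ' :=
  let ⟨I, hI, A⟩ := h
  ⟨I, hI.trans hκ, A⟩

theorem mk_quasiIdentity_le {κ : Cardinal.{u}} (hκ : ℵ₀ ≤ κ)
    (hL : #(Σ n, L.Functions n) ≤ κ) : #(QuasiIdentity L) ≤ κ := by
  have hterm : ∀ n : ℕ, #(L.Term (Fin n)) ≤ κ := fun n => by
    refine Term.card_le.trans (max_le hκ ?_)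
    rw [mk_sum]
    refine add_le_of_le hκ ?_ ?_
    · simpa using (natCast_lt_aleph0 (n := n)).le.trans hκ
    · simpa using hL
  have hpair : ∀ n : ℕ, #(L.Term (Fin n) × L.Term (Fin n)) ≤ κ := fun n => by
    rw [← mul_def]
    exact mul_le_of_le hκ (hterm n) (hterm n)
  have hemb : ∀ n : ℕ, Nonempty (List (L.Term (Fin n) × L.Term (Fin n)) ×
      (L.Term (Fin n) × L.Term (Fin n)) ↪ κ.out) := fun n => by
    rw [← Cardinal.le_def, ← mul_def, mk_out]
    exact mul_le_of_le hκ ((mk_list_le_max _).trans (max_le hκ (hpair n))) (hpair n)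
  let g := fun n => (hemb n).some
  have hinj : Function.Injective fun φ : QuasiIdentity L =>
      ((ULift.up φ.n, g φ.n (φ.premises, φ.conclusion)) : ULift.{u} ℕ × κ.out) := by
    rintro ⟨n, p, c⟩ ⟨n', p', c'⟩ h
    obtain ⟨h1, h2⟩ := Prod.ext_iff.1 h
    obtain rfl : n = n' := congrArg ULift.down h1
    obtain ⟨rfl, rfl⟩ := Prod.ext_iff.1 ((g n).injective h2)
    rfl
  refine (mk_le_of_injective hinj).trans ?_
  rw [← mul_def, mk_out, mk_uLift, mk_nat, lift_aleph0]
  exact mul_le_of_le hκ hκ le_rfl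

/-! ### Sets with constants -/

variable {C : Type u}

theorem setsWithConstants_isVariety : IsVariety (setsWithConstants C) :=
  ⟨∅, by simp, by simp [setsWithConstants]⟩

theorem IsVariety.isQuasivariety {L : FirstOrder.Language.{u, 0}} {P : Set (Alg L)}
    (hP : IsVariety P) : IsQuasivariety P :=
  let ⟨Γ, _, hΓ⟩ := hP
  ⟨Γ, hΓ⟩

theorem setsWithConstants_generatedByAtMost {κ : Cardinal.{u}} (hκ : ℵ₀ ≤ κ) (hC : #C = κ) :
    GeneratedByAtMost (setsWithConstants C) κ := by
  refine setsWithConstants_isVariety.isQuasivariety.generatedByAtMost.mono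
    (mk_quasiIdentity_le hκ ?_)
  rw [← hC]
  refine mk_le_of_surjective (f := fun c : C => ⟨0, c⟩) ?_
  rintro ⟨_ | n, c⟩
  · exact ⟨c, rfl⟩
  · exact c.elim

/-- The two-element algebra in which the constants in `s` name one element and all other constants
the other. -/
def twoElementAlg (s : Set C) : Alg (constantsOn C) :=
  ⟨ULift.{u} Prop, constantsOn.structure fun c => ULift.up (c ∈ s)⟩

/-- The element of `A` named by the constant `c`. -/
def constantValue (A : Alg (constantsOn C)) (c : C) : A :=
  funMap (L := constantsOn C) (n := 0) c Fin.elim0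

theorem map_constantValue {A B : Alg (constantsOn C)} (f : A →[constantsOn C] B) (c : C) :
    f (constantValue A c) = constantValue B c :=
  (f.map_fun _ _).trans (congrArg _ (Subsingleton.elim _ _))

theorem constantValue_eq_iff {A B : Alg (constantsOn C)} {f : A →[constantsOn C] B}
    (hf : Function.Injective f) (c d : C) :
    constantValue A c = constantValue A d ↔ constantValue B c = constantValue B d := by
  rw [← map_constantValue f, ← map_constantValue f, hf.eq_iff]

theorem constantValue_twoElementAlg_eq_iff (s : Set C) (c d : C) :
    constantValue (twoElementAlg s) c = constantValue (twoElementAlg s) d ↔ (c ∈ s ↔ d ∈ s) :=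
  ULift.up_injective.eq_iff.trans eq_iff_iff

/-- A map separating the only two elements is injective. -/
theorem twoElementAlg_isSubdirectlyIrreducibleIn (s : Set C) :
    IsSubdirectlyIrreducibleIn (setsWithConstants C) (twoElementAlg s) := by
  refine ⟨trivial, fun I B f _ hf hsep => ?_⟩
  have hne : (ULift.up True : twoElementAlg s) ≠ ULift.up False := fun h =>
    true_ne_false (ULift.up_injective h)
  obtain ⟨i, hi⟩ : ∃ i, f i (ULift.up True) ≠ f i (ULift.up False) := by
    by_contra! h
    exact hne (hsep _ _ h)
  refine ⟨i, ?_, hf i⟩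
  rintro ⟨p⟩ ⟨q⟩ hpq
  obtain rfl | rfl := Classical.propComplete p <;> obtain rfl | rfl := Classical.propComplete q
  exacts [rfl, absurd hpq hi, absurd hpq.symm hi, rfl]

theorem setsWithConstants_not_decomposesIntoAtMost {κ : Cardinal.{u}} (hκ : ℵ₀ ≤ κ) (hC : #C = κ) :
    ¬ DecomposesIntoAtMost (setsWithConstants C) κ := by
  intro h
  obtain ⟨I, hI, Y, hXY, hY⟩ := h (Set.range twoElementAlg) (small_range _) (by
    rintro _ ⟨s, rfl⟩
    exact twoElementAlg_isSubdirectlyIrreducibleIn s)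
  have hmem : ∀ s : Set C, ∃ i, twoElementAlg s ∈ Y i := fun s =>
    Set.mem_iUnion.1 (hXY ▸ Set.mem_range_self s)
  choose i hi using hmem
  obtain ⟨c₀⟩ : Nonempty C := mk_ne_zero_iff.1 (hC ▸ (aleph0_pos.trans_le hκ).ne')
  -- Within one compatible piece, `s` is determined up to complement; the bit `c₀ ∈ s` decides
  -- which. Hence `2 ^ κ ≤ κ * 2`.
  have hinj : Function.Injective fun s : Set C => (i s, (ULift.up (c₀ ∈ s) : ULift.{u} Prop)) := by
    intro s t hst
    obtain ⟨hst, h₀⟩ := Prod.ext_iff.1 hst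
    replace h₀ : c₀ ∈ s ↔ c₀ ∈ t := iff_of_eq (ULift.up_injective h₀)
    obtain ⟨-, B, -, hB⟩ := hY (i s)
    obtain ⟨f, hf⟩ := hB _ (hi s)
    obtain ⟨g, hg⟩ := hB (twoElementAlg t) (by
      rw [show i s = i t from hst]
      exact hi t)
    ext c
    have := (constantValue_eq_iff hf c c₀).trans (constantValue_eq_iff hg c c₀).symm
    rw [constantValue_twoElementAlg_eq_iff, constantValue_twoElementAlg_eq_iff] at this
    tauto
  have hle := mk_le_of_injective hinj
  rw [mk_set, hC, ← mul_def] at hle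
  refine (cantor κ).not_ge (hle.trans (mul_le_of_le hκ hI ?_))
  simpa using (natCast_lt_aleph0 (n := 2)).le.trans hκ

end UniversalAlgebra

theorem corollary8p5 :
    (∀ (L : FirstOrder.Language.{u, 0}) [L.IsAlgebraic] (P : Set (UniversalAlgebra.Alg L)),
      UniversalAlgebra.IsQuasivariety P → ∀ κ : Cardinal.{u},
        (UniversalAlgebra.DecomposesIntoAtMost P κ → UniversalAlgebra.GeneratedByAtMost P κ) ∧
        (κ < ℵ₀ →
          UniversalAlgebra.GeneratedByAtMost P κ → UniversalAlgebra.DecomposesIntoAtMost P κ)) ∧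
    (∀ κ : Cardinal.{u}, ℵ₀ ≤ κ → ∀ C : Type u, #C = κ →
      UniversalAlgebra.IsVariety (UniversalAlgebra.setsWithConstants C) ∧
      UniversalAlgebra.IsQuasivariety (UniversalAlgebra.setsWithConstants C) ∧
      UniversalAlgebra.GeneratedByAtMost (UniversalAlgebra.setsWithConstants C) κ ∧
      ¬ UniversalAlgebra.DecomposesIntoAtMost (UniversalAlgebra.setsWithConstants C) κ) :=
  ⟨fun _ _ _ hP _ => ⟨.of_decomposesIntoAtMost hP, fun hκ h => h.decomposesIntoAtMost hP hκ⟩,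
    fun _ hκ _ hC => ⟨UniversalAlgebra.setsWithConstants_isVariety,
      UniversalAlgebra.setsWithConstants_isVariety.isQuasivariety,
      UniversalAlgebra.setsWithConstants_generatedByAtMost hκ hC,
      UniversalAlgebra.setsWithConstants_not_decomposesIntoAtMost hκ hC⟩⟩
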